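/- Theorem (Gumbel processes from exponential races). Write $\mathbb{R}^+=(0,\infty)$, let $\lambda$ be Lebesgue measure on $\mathbb{R}^+$, let $P$ be a finite nonzero Borel measure on $\mathbb{R}^n$, and let all sets below be Borel. A random set $R\subseteq\mathbb{R}^+\times\mathbb{R}^n$ is an exponential race with measure $P$ if it is almost surely countable; for every $B\subseteq\mathbb{R}^+\times\mathbb{R}^n$ the count $N(B)=\#(R\cap B)\in\{0,1,\dots,\infty\}$ is $\mathrm{Poisson}((\lambda\times P)(B))$ distributed (rate $\infty$ meaning $N(B)=\infty$ almost surely); the counts $N(A_1),\dots,N(A_m)$ are independent for every finite family of pairwise disjoint sets $A_j$; and almost surely no two distinct points of $R$ have the same first coordinate (so $R$ is totally ordered by time). A random variable $Y$ is $\mathrm{Gumbel}(\mu)$ distributed, $\mu\in\mathbb{R}$, if it is almost surely real and $\mathbb{P}(Y\le g)=\exp(-\exp(-g+\mu))$ for all $g\in\mathbb{R}$; $\mathrm{Gumbel}(-\infty)$ is the law of the constant $-\infty$. We use $\log 0=-\infty$, $\log\infty=\infty$, $\min\emptyset=\infty$ and $\max\emptyset=-\infty$. Let $R$ be an exponential race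 with measure $P$ and set $$G(x)=-\log\min\{t : (t,x)\in R\},\qquad x\in\mathbb{R}^n.$$ Then $G$ is a Gumbel process with measure $P$. That is: almost surely, the minimum exists for every $x$ at which there is an arrival, $G(x)\in\mathbb{R}\cup\{-\infty\}$ for all $x$, and $G^*(B)=\max_{x\in B}G(x)$ exists for all nonempty $B\subseteq\mathbb{R}^n$ simultaneously; for every $B\subseteq\mathbb{R}^n$, $G^*(B)\sim\mathrm{Gumbel}(\log P(B))$; and for every finite family of pairwise disjoint sets $A_1,\dots,A_m\subseteq\mathbb{R}^n$, the variables $G^*(A_1),\dots,G^*(A_m)$ are independent. -/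

import Mathlib

open MeasureTheory ProbabilityTheory
open scoped ENNReal

noncomputable section

/-- The Poisson law on `{0, 1, …, ∞}` with rate `r ∈ [0, ∞]`; rate `∞` gives the point mass
at `∞` (and rate `0` the point mass at `0`). -/
def poissonLaw (r : ℝ≥0∞) : Measure ℕ∞ :=
  if r = ∞ then Measure.dirac ⊤
  else (poissonMeasure r.toNNReal).map (fun k : ℕ => (k : ℕ∞))

/-- `N(B) = #(S ∩ B)`, with value `∞` when `S ∩ B` is infinite. -/
def pointCount {X : Type*} (S B : Set X) : ℕ∞ := (S ∩ B).encard

/-- The random set `S` on the probability space `(Ω, Pr)` is a Poisson process on `X` with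
σ-finite nonatomic mean measure `μ`: it is (almost surely) countable, the counts of measurable
sets are Poisson with rate given by `μ`, and the counts of finitely many disjoint measurable sets
are independent. -/
structure IsPoissonProcess {Ω : Type*} [MeasurableSpace Ω] (Pr : Measure Ω)
    {X : Type*} [MeasurableSpace X] (μ : Measure X) [SigmaFinite μ] [NullSingletonClass μ]
    (S : Ω → Set X) : Prop where
  countable : ∀ᵐ ω ∂Pr, (S ω).Countable
  hasLaw_count : ∀ B : Set X, MeasurableSet B →
    HasLaw (fun ω => pointCount (S ω) B) (poissonLaw (μ B)) Pr
  indep_count : ∀ (m : ℕ) (A : Fin m → Set X), (∀ j, MeasurableSet (A j)) →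
    Pairwise (fun i j => Disjoint (A i) (A j)) →
    iIndepFun (fun j ω => pointCount (S ω) (A j)) Pr

/-- Time-space `ℝ⁺ × ℝⁿ`, where `ℝ⁺ = (0, ∞)`. -/
abbrev RaceSpace (n : ℕ) : Type := Set.Ioi (0 : ℝ) × EuclideanSpace ℝ (Fin n)

/-- Lebesgue measure on `ℝ⁺`. -/
def timeMeasure : Measure (Set.Ioi (0 : ℝ)) := (volume : Measure ℝ).comap Subtype.val

theorem timeMeasure_apply (s : Set (Set.Ioi (0 : ℝ))) :
    timeMeasure s = volume (Subtype.val '' s : Set ℝ) :=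
  (MeasurableEmbedding.subtype_coe measurableSet_Ioi).comap_apply _ _

instance timeMeasure_sigmaFinite : SigmaFinite timeMeasure :=
  SigmaFinite.of_map _ measurable_subtype_coe.aemeasurable (by
    rw [timeMeasure, (MeasurableEmbedding.subtype_coe measurableSet_Ioi).map_comap]
    infer_instance)

instance timeMeasure_nullSingleton : NullSingletonClass timeMeasure :=
  ⟨fun x => by simp [timeMeasure_apply]⟩

/-- The random set `R ⊆ ℝ⁺ × ℝⁿ` is an exponential race with finite nonzero measure `P`: it is a
Poisson process whose mean measure is the product of Lebesgue measure on `ℝ⁺` with `P`, and it is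
(almost surely) totally ordered by time, i.e. no two distinct points share their time. -/
structure IsExponentialRace {Ω : Type*} [MeasurableSpace Ω] (Pr : Measure Ω) {n : ℕ}
    (P : Measure (EuclideanSpace ℝ (Fin n))) [IsFiniteMeasure P] [NeZero P]
    (R : Ω → Set (RaceSpace n)) : Prop where
  poisson : IsPoissonProcess Pr (timeMeasure.prod P) R
  ordered : ∀ᵐ ω ∂Pr, Set.InjOn (fun p : RaceSpace n => p.1) (R ω)

/-- `Y ∼ Gumbel(a)` for a location `a ∈ ℝ ∪ {-∞}`. For real `a`, `Y` is (almost surely) real with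
distribution function `g ↦ exp (-exp (-g + a))`; for `a = -∞`, `Y = -∞` almost surely. -/
def IsGumbel {Ω : Type*} [MeasurableSpace Ω] (Pr : Measure Ω) (Y : Ω → EReal) (a : EReal) : Prop :=
  AEMeasurable Y Pr ∧
    ((a = ⊥ ∧ ∀ᵐ ω ∂Pr, Y ω = ⊥) ∨
      ∃ c : ℝ, a = (c : EReal) ∧ (∀ᵐ ω ∂Pr, ∃ y : ℝ, Y ω = (y : EReal)) ∧
        ∀ g : ℝ, Pr {ω | Y ω ≤ (g : EReal)} = ENNReal.ofReal (Real.exp (-Real.exp (-g + c))))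

/-- `G^*(B) = max_{x ∈ B} G(x)`, with the value `-∞` for `B = ∅`. -/
def maxOver {E : Type*} (G : E → EReal) (B : Set E) : EReal := ⨆ x ∈ B, G x

/-- The random function `G : ℝⁿ → ℝ ∪ {-∞}` is a Gumbel process with finite nonzero measure `P`.
Values and maxima are as required outside one null event: `G` nowhere takes the value `+∞`, and
the maximum over every nonempty Borel set is attained. -/
structure IsGumbelProcess {Ω : Type*} [MeasurableSpace Ω] (Pr : Measure Ω) {n : ℕ}
    (P : Measure (EuclideanSpace ℝ (Fin n))) [IsFiniteMeasure P] [NeZero P]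
    (G : Ω → EuclideanSpace ℝ (Fin n) → EReal) : Prop where
  lt_top : ∀ᵐ ω ∂Pr, ∀ x, G ω x < ⊤
  max_exists : ∀ᵐ ω ∂Pr, ∀ B : Set (EuclideanSpace ℝ (Fin n)), MeasurableSet B → B.Nonempty →
    ∃ x ∈ B, ∀ y ∈ B, G ω y ≤ G ω x
  gumbel_max : ∀ B : Set (EuclideanSpace ℝ (Fin n)), MeasurableSet B →
    IsGumbel Pr (fun ω => maxOver (G ω) B) (ENNReal.log (P B))
  indep_max : ∀ (m : ℕ) (A : Fin m → Set (EuclideanSpace ℝ (Fin n))),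
    (∀ j, MeasurableSet (A j)) → Pairwise (fun i j => Disjoint (A i) (A j)) →
    iIndepFun (fun j ω => maxOver (G ω) (A j)) Pr

/-- The set `{T_i : (T_i, x) ∈ R}` of arrival times at `x`. -/
def arrivalTimes {n : ℕ} (R : Set (RaceSpace n)) (x : EuclideanSpace ℝ (Fin n)) :
    Set (Set.Ioi (0 : ℝ)) := {t | (t, x) ∈ R}

/-- `T(x) = min {T_i : (T_i, x) ∈ R}`, with the value `∞` when there is no arrival at `x`. -/
def firstArrival {n : ℕ} (R : Set (RaceSpace n)) (x : EuclideanSpace ℝ (Fin n)) : ℝ≥0∞ :=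
  ⨅ t ∈ arrivalTimes R x, ENNReal.ofReal (t : ℝ)

/-- `G(x) = -log min {T_i : (T_i, x) ∈ R}`, with `-log ∞ = -∞`. -/
def raceGumbel {n : ℕ} (R : Set (RaceSpace n)) (x : EuclideanSpace ℝ (Fin n)) : EReal :=
  -ENNReal.log (firstArrival R x)

end

/-! Let T(B) be the infimum of the arrival times in B. Then T(B) ≥ s exactly when the strip (0, s) ×
B contains no point of the race (`le_firstArrivalIn_iff`), so the law of T is read off from Poisson
void probabilities. The strip has mean s · P(B), hence T(B) ≥ s has probability exp(-s P(B)).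
Disjoint sets B give disjoint strips, hence independent times (`iIndepFun_firstArrivalIn`). Since
-log reverses order, G*(B) = -log T(B), and s = exp(-g) turns the exponential tail into the Gumbel
distribution function. Existence of minima and maxima is pathwise: almost surely each (0, k) × ℝⁿ
holds finitely many points, and on that one event every nonempty set of arrivals has an earliest
member (`exists_earliest`). -/

/-- The times strictly before `s`. -/
def timesBefore (s : ℝ≥0∞) : Set (Set.Ioi (0 : ℝ)) := {t | ENNReal.ofReal (t : ℝ) < s}

theorem mem_timesBefore {s : ℝ≥0∞} {t : Set.Ioi (0 : ℝ)} :
    t ∈ timesBefore s ↔ ENNReal.ofReal (t : ℝ) < s := Iff.rfl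

theorem measurableSet_timesBefore (s : ℝ≥0∞) : MeasurableSet (timesBefore s) :=
  measurableSet_lt (by fun_prop) measurable_const

theorem timeMeasure_timesBefore (s : ℝ≥0∞) : timeMeasure (timesBefore s) = s := by
  rw [timeMeasure_apply]
  induction s with
  | top =>
    have : (Subtype.val '' timesBefore ⊤ : Set ℝ) = Set.Ioi 0 := by
      ext x; simp [timesBefore]
    rw [this, Real.volume_Ioi]
  | coe s =>
    have : (Subtype.val '' timesBefore s : Set ℝ) = Set.Ioo 0 (s : ℝ) := by
      ext x
      simp only [timesBefore, Set.mem_image, Set.mem_ofPred_eq, Subtype.exists, Set.mem_Ioi,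
        exists_and_left, exists_prop, exists_eq_right_right, Set.mem_Ioo]
      rw [and_comm]
      refine and_congr_right fun hx => ?_
      rw [ENNReal.ofReal_lt_iff_lt_toReal hx.le ENNReal.coe_ne_top, ENNReal.coe_toReal]
    rw [this, Real.volume_Ioo, sub_zero, ENNReal.ofReal_coe_nnreal]

theorem poissonLaw_singleton_zero {r : ℝ≥0∞} (hr : r ≠ ∞) :
    poissonLaw r {0} = ENNReal.ofReal (Real.exp (-r.toReal)) := by
  rw [poissonLaw, if_neg hr, Measure.map_apply (measurable_of_countable _) (.singleton 0)]
  have : (fun k : ℕ => (k : ℕ∞)) ⁻¹' {0} = {0} := by ext; simp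
  rw [this, poissonMeasure_singleton]
  simp [ENNReal.toReal]

theorem poissonLaw_ae_ne_top {r : ℝ≥0∞} (hr : r ≠ ∞) : ∀ᵐ k ∂poissonLaw r, k ≠ ⊤ := by
  rw [poissonLaw, if_neg hr, ae_map_iff (measurable_of_countable _).aemeasurable (.of_discrete)]
  simp

theorem poissonLaw_ae_ne_zero_of_eq_top : ∀ᵐ k ∂poissonLaw ∞, k ≠ 0 := by
  simp [poissonLaw]

theorem poissonLaw_zero_ae_eq_zero : ∀ᵐ k ∂poissonLaw 0, k = 0 := by
  rw [poissonLaw, if_neg ENNReal.zero_ne_top,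
    ae_map_iff (measurable_of_countable _).aemeasurable (.of_discrete)]
  refine ae_iff_of_countable.2 fun k hk => ?_
  by_contra h
  have hk0 : k ≠ 0 := fun h0 => h (by simp [h0])
  exact hk (by simp [poissonMeasure_singleton, hk0])

section Race

variable {n : ℕ}

/-- The time of the first arrival in `B`. -/
noncomputable def firstArrivalIn (S : Set (RaceSpace n)) (B : Set (EuclideanSpace ℝ (Fin n))) :
    ℝ≥0∞ := ⨅ x ∈ B, firstArrival S x

/-- Because `timesBefore` is strict, this needs no attained infimum; it includes `s = ∞`, where it
says that nothing ever arrives in `B`. -/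
theorem le_firstArrivalIn_iff {S : Set (RaceSpace n)} {B : Set (EuclideanSpace ℝ (Fin n))}
    {s : ℝ≥0∞} : s ≤ firstArrivalIn S B ↔ pointCount S (timesBefore s ×ˢ B) = 0 := by
  simp only [firstArrivalIn, firstArrival, arrivalTimes, le_iInf_iff, pointCount,
    Set.encard_eq_zero, Set.eq_empty_iff_forall_notMem, Set.mem_inter_iff, Set.mem_prod,
    mem_timesBefore, Set.mem_ofPred_eq, Prod.forall, not_and]
  simp only [← not_lt (b := s)]
  exact ⟨fun h t x hx ht hB => h x hB t hx ht, fun h x hB t hx ht => h t x hx ht hB⟩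

theorem preimage_Ici_firstArrivalIn {Ω : Type*} (R : Ω → Set (RaceSpace n))
    (B : Set (EuclideanSpace ℝ (Fin n))) (s : ℝ≥0∞) :
    (fun ω => firstArrivalIn (R ω) B) ⁻¹' Set.Ici s =
      (fun ω => pointCount (R ω) (timesBefore s ×ˢ B)) ⁻¹' {0} := by
  ext ω
  exact le_firstArrivalIn_iff

/-- The map -log is an order-reversing bijection from [0, ∞] to the extended reals, so it carries
infima to suprema, attained or not. -/
theorem maxOver_raceGumbel (S : Set (RaceSpace n)) (B : Set (EuclideanSpace ℝ (Fin n))) :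
    maxOver (raceGumbel S) B = -ENNReal.log (firstArrivalIn S B) := by
  rw [firstArrivalIn]
  exact ((ENNReal.logOrderIso.trans EReal.negOrderIso).map_iInf₂ _).symm

/-- If only finitely many arrivals occur before each time, the earliest of any nonempty set of
arrivals exists. -/
theorem exists_earliest {S T : Set (RaceSpace n)}
    (hfin : ∀ k : ℕ, pointCount S (timesBefore k ×ˢ Set.univ) ≠ ⊤) (hTS : T ⊆ S)
    (hT : T.Nonempty) : ∃ p ∈ T, ∀ q ∈ T, p.1 ≤ q.1 := by
  obtain ⟨p, hp⟩ := hT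
  obtain ⟨k, hk⟩ := exists_nat_gt (p.1 : ℝ)
  have hpk : p.1 ∈ timesBefore k := by
    rw [mem_timesBefore, ← ENNReal.ofReal_natCast]
    exact (ENNReal.ofReal_lt_ofReal_iff (p.1.2.trans hk)).2 hk
  have hF : (T ∩ timesBefore k ×ˢ Set.univ).Finite :=
    (Set.encard_ne_top_iff.1 (hfin k)).subset (Set.inter_subset_inter_left _ hTS)
  -- A minimizer among the finitely many points before time `k` also precedes every point at or
  -- after `k`.
  obtain ⟨q, hq, hmin⟩ := hF.exists_minimalFor (fun p => p.1) _ ⟨p, hp, hpk, trivial⟩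
  refine ⟨q, hq.1, fun r hr => ?_⟩
  by_cases hrk : r.1 ∈ timesBefore k
  · exact (le_total q.1 r.1).elim id fun h => hmin ⟨hr, hrk, trivial⟩ h
  · exact le_of_not_gt fun h => hrk <| mem_timesBefore.2 <|
      (ENNReal.ofReal_le_ofReal h.le).trans_lt (mem_timesBefore.1 hq.2.1)

theorem exists_isLeast_arrivalTimes {S : Set (RaceSpace n)}
    (hfin : ∀ k : ℕ, pointCount S (timesBefore k ×ˢ Set.univ) ≠ ⊤)
    {x : EuclideanSpace ℝ (Fin n)} (hx : (arrivalTimes S x).Nonempty) :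
    ∃ t, IsLeast (arrivalTimes S x) t := by
  obtain ⟨t, ht⟩ := hx
  obtain ⟨p, ⟨hpS, rfl⟩, hmin⟩ :=
    exists_earliest hfin (T := {p | p ∈ S ∧ p.2 = x}) (fun p hp => hp.1) ⟨(t, x), ht, rfl⟩
  exact ⟨p.1, hpS, fun s hs => hmin (s, p.2) ⟨hs, rfl⟩⟩

theorem exists_firstArrival_le {S : Set (RaceSpace n)}
    (hfin : ∀ k : ℕ, pointCount S (timesBefore k ×ˢ Set.univ) ≠ ⊤)
    {B : Set (EuclideanSpace ℝ (Fin n))} (hB : B.Nonempty) :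
    ∃ x ∈ B, ∀ y ∈ B, firstArrival S x ≤ firstArrival S y := by
  by_cases h : ({p | p ∈ S ∧ p.2 ∈ B} : Set (RaceSpace n)).Nonempty
  · obtain ⟨p, hp, hmin⟩ := exists_earliest hfin (fun p hp => hp.1) h
    refine ⟨p.2, hp.2, fun y hy => le_iInf₂ fun t ht => ?_⟩
    exact (iInf₂_le p.1 hp.1).trans (ENNReal.ofReal_le_ofReal (hmin (t, y) ⟨ht, hy⟩))
  · obtain ⟨x, hx⟩ := hB
    refine ⟨x, hx, fun y hy => (le_iInf₂ fun t ht => ?_)⟩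
    exact absurd ⟨(t, y), ht, hy⟩ h

theorem firstArrival_pos {S : Set (RaceSpace n)}
    (hfin : ∀ k : ℕ, pointCount S (timesBefore k ×ˢ Set.univ) ≠ ⊤)
    (x : EuclideanSpace ℝ (Fin n)) : 0 < firstArrival S x := by
  by_cases h : (arrivalTimes S x).Nonempty
  · obtain ⟨t, ht, hmin⟩ := exists_isLeast_arrivalTimes hfin h
    exact (ENNReal.ofReal_pos.2 t.2).trans_le
      (le_iInf₂ fun s hs => ENNReal.ofReal_le_ofReal (hmin hs))
  · refine ENNReal.zero_lt_top.trans_le (le_iInf₂ fun t ht => absurd ⟨t, ht⟩ h)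

theorem raceGumbel_lt_top_iff {S : Set (RaceSpace n)} {x : EuclideanSpace ℝ (Fin n)} :
    raceGumbel S x < ⊤ ↔ 0 < firstArrival S x := by
  rw [raceGumbel, EReal.neg_lt_comm, EReal.neg_top, ENNReal.bot_lt_log_iff]

variable {Ω : Type*} [MeasurableSpace Ω] {Pr : Measure Ω}
  {P : Measure (EuclideanSpace ℝ (Fin n))} [IsFiniteMeasure P] {R : Ω → Set (RaceSpace n)}

theorem hasLaw_pointCount_timesBefore (hR : IsPoissonProcess Pr (timeMeasure.prod P) R)
    {B : Set (EuclideanSpace ℝ (Fin n))} (hB : MeasurableSet B) (s : ℝ≥0∞) :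
    HasLaw (fun ω => pointCount (R ω) (timesBefore s ×ˢ B)) (poissonLaw (s * P B)) Pr := by
  have := hR.hasLaw_count _ ((measurableSet_timesBefore s).prod hB)
  rwa [Measure.prod_prod, timeMeasure_timesBefore] at this

/-- Each strip has finite mean k · P(ℝⁿ). Only countably many `k` occur, so a single null set serves
all locations and all sets at once. -/
theorem ae_pointCount_timesBefore_ne_top (hR : IsPoissonProcess Pr (timeMeasure.prod P) R) :
    ∀ᵐ ω ∂Pr, ∀ k : ℕ, pointCount (R ω) (timesBefore k ×ˢ Set.univ) ≠ ⊤ := by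
  refine ae_all_iff.2 fun k => ?_
  refine ((hasLaw_pointCount_timesBefore hR .univ k).ae_iff
    (p := fun c : ℕ∞ => c ≠ ⊤) measurable_from_top).2 (poissonLaw_ae_ne_top ?_)
  exact ENNReal.mul_ne_top (ENNReal.natCast_ne_top k) (measure_ne_top P _)

theorem aemeasurable_firstArrivalIn (hR : IsPoissonProcess Pr (timeMeasure.prod P) R)
    {B : Set (EuclideanSpace ℝ (Fin n))} (hB : MeasurableSet B) :
    AEMeasurable (fun ω => firstArrivalIn (R ω) B) Pr := by
  have h (s : ℝ≥0∞) :
      NullMeasurableSet ((fun ω => firstArrivalIn (R ω) B) ⁻¹' Set.Ici s) Pr := by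
    rw [preimage_Ici_firstArrivalIn]
    exact (hasLaw_pointCount_timesBefore hR hB s).aemeasurable.nullMeasurable
      (MeasurableSet.singleton 0)
  -- Counts are only a.e. measurable, so the generating rays are tested in the completed σ-algebra.
  exact NullMeasurable.aemeasurable (measurable_of_Ici (δ := NullMeasurableSpace Ω Pr) h)

theorem measure_le_firstArrivalIn (hR : IsPoissonProcess Pr (timeMeasure.prod P) R)
    {B : Set (EuclideanSpace ℝ (Fin n))} (hB : MeasurableSet B) {s : ℝ≥0∞} (hs : s ≠ ∞) :
    Pr {ω | s ≤ firstArrivalIn (R ω) B} = ENNReal.ofReal (Real.exp (-(s * P B).toReal)) := by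
  simp only [le_firstArrivalIn_iff]
  rw [(hasLaw_pointCount_timesBefore hR hB s).measure_eq (p := fun c => c = 0) (.singleton 0)]
  exact poissonLaw_singleton_zero (ENNReal.mul_ne_top hs (measure_ne_top P B))

theorem ae_firstArrivalIn_eq_top (hR : IsPoissonProcess Pr (timeMeasure.prod P) R)
    {B : Set (EuclideanSpace ℝ (Fin n))} (hB : MeasurableSet B) (h : P B = 0) :
    ∀ᵐ ω ∂Pr, firstArrivalIn (R ω) B = ∞ := by
  have hlaw := hasLaw_pointCount_timesBefore hR hB ∞
  -- The infinite strip has rate `∞ * 0 = 0`.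
  rw [h, mul_zero] at hlaw
  filter_upwards [(hlaw.ae_iff (p := fun c : ℕ∞ => c = 0) measurable_from_top).2
    poissonLaw_zero_ae_eq_zero] with ω hω
  exact top_le_iff.1 (le_firstArrivalIn_iff.2 hω)

theorem ae_firstArrivalIn_ne_top (hR : IsPoissonProcess Pr (timeMeasure.prod P) R)
    {B : Set (EuclideanSpace ℝ (Fin n))} (hB : MeasurableSet B) (h : P B ≠ 0) :
    ∀ᵐ ω ∂Pr, firstArrivalIn (R ω) B ≠ ∞ := by
  have hlaw := hasLaw_pointCount_timesBefore hR hB ∞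
  rw [ENNReal.top_mul h] at hlaw
  filter_upwards [(hlaw.ae_iff (p := fun c : ℕ∞ => c ≠ 0) measurable_from_top).2
    poissonLaw_ae_ne_zero_of_eq_top] with ω hω
  exact fun h => hω (le_firstArrivalIn_iff.1 h.ge)

theorem ae_firstArrivalIn_ne_zero (hR : IsPoissonProcess Pr (timeMeasure.prod P) R)
    (B : Set (EuclideanSpace ℝ (Fin n))) : ∀ᵐ ω ∂Pr, firstArrivalIn (R ω) B ≠ 0 := by
  filter_upwards [ae_pointCount_timesBefore_ne_top hR] with ω hfin
  rcases B.eq_empty_or_nonempty with rfl | hB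
  · simp [firstArrivalIn]
  · obtain ⟨x, -, hx⟩ := exists_firstArrival_le hfin hB
    exact ((firstArrival_pos hfin x).trans_le (le_iInf₂ hx)).ne'

theorem isGumbel_maxOver (hR : IsPoissonProcess Pr (timeMeasure.prod P) R)
    {B : Set (EuclideanSpace ℝ (Fin n))} (hB : MeasurableSet B) :
    IsGumbel Pr (fun ω => maxOver (raceGumbel (R ω)) B) (ENNReal.log (P B)) := by
  simp only [maxOver_raceGumbel]
  refine ⟨(ENNReal.measurable_log.comp_aemeasurable (aemeasurable_firstArrivalIn hR hB)).neg, ?_⟩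
  by_cases h : P B = 0
  · refine .inl ⟨by simp [h], ?_⟩
    filter_upwards [ae_firstArrivalIn_eq_top hR hB h] with ω hω
    simp [hω]
  · have hpos : 0 < (P B).toReal := ENNReal.toReal_pos h (measure_ne_top P B)
    refine .inr ⟨Real.log (P B).toReal, ENNReal.log_pos_real h (measure_ne_top P B), ?_, ?_⟩
    · filter_upwards [ae_firstArrivalIn_ne_top hR hB h, ae_firstArrivalIn_ne_zero hR B]
        with ω h1 h2
      exact ⟨-Real.log (firstArrivalIn (R ω) B).toReal, by
        rw [ENNReal.log_pos_real h2 h1, EReal.coe_neg]⟩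
    · intro g
      have hlog : ENNReal.log (ENNReal.ofReal (Real.exp (-g))) = -(g : EReal) := by
        rw [ENNReal.log_ofReal_of_pos (Real.exp_pos _), Real.log_exp, EReal.coe_neg]
      have hset : {ω | -ENNReal.log (firstArrivalIn (R ω) B) ≤ (g : EReal)} =
          {ω | ENNReal.ofReal (Real.exp (-g)) ≤ firstArrivalIn (R ω) B} := by
        ext ω
        rw [Set.mem_ofPred_eq, Set.mem_ofPred_eq, ← ENNReal.log_le_log_iff, hlog, EReal.neg_le]
      rw [hset, measure_le_firstArrivalIn hR hB ENNReal.ofReal_ne_top, ENNReal.toReal_mul,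
        ENNReal.toReal_ofReal (Real.exp_pos _).le, Real.exp_add, Real.exp_log hpos]

theorem iIndepFun_firstArrivalIn [IsProbabilityMeasure Pr]
    (hR : IsPoissonProcess Pr (timeMeasure.prod P) R) {m : ℕ}
    {A : Fin m → Set (EuclideanSpace ℝ (Fin n))} (hA : ∀ j, MeasurableSet (A j))
    (hdisj : Pairwise (fun i j => Disjoint (A i) (A j))) :
    iIndepFun (fun j ω => firstArrivalIn (R ω) (A j)) Pr := by
  have hmeas j := aemeasurable_firstArrivalIn hR (hA j)
  have hprob j : IsProbabilityMeasure (Pr.map (fun ω => firstArrivalIn (R ω) (A j))) :=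
    Measure.isProbabilityMeasure_map (hmeas j)
  rw [iIndepFun_iff_map_fun_eq_pi_map hmeas]
  symm
  -- The joint law is compared with the product law on boxes of rays [b, ∞], a generating π-system;
  -- `Ici 0` is the whole space.
  refine Measure.pi_eq_generateFrom (C := fun _ => Set.range Set.Ici)
    (fun _ => by rw [← borel_eq_generateFrom_Ici]; exact BorelSpace.measurable_eq.symm)
    (fun _ => isPiSystem_Ici)
    (fun j => ⟨fun _ => Set.univ, fun _ => ⟨0, by ext; simp⟩, fun _ => measure_lt_top _ _,
      Set.iUnion_const _⟩) fun s hs => ?_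
  choose b hb using hs
  obtain rfl : (fun j => Set.Ici (b j)) = s := funext hb
  rw [Measure.map_apply_of_aemeasurable (aemeasurable_pi_lambda _ hmeas)
    (.univ_pi fun j => measurableSet_Ici)]
  simp only [fun j => Measure.map_apply_of_aemeasurable (hmeas j) (measurableSet_Ici (a := b j))]
  -- The strips may have different heights `b j`; they are disjoint because their bases are.
  have hind := hR.indep_count m (fun j => timesBefore (b j) ×ˢ A j)
    (fun j => (measurableSet_timesBefore _).prod (hA j))
    (fun i j hij => Set.disjoint_prod.2 (.inr (hdisj hij)))
  have key := hind.measure_inter_preimage_eq_mul Finset.univ (sets := fun _ => {0})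
    (fun _ _ => .singleton 0)
  simp only [preimage_Ici_firstArrivalIn, ← key]
  congr 1
  ext ω
  simp [Pi.le_def, le_firstArrivalIn_iff]

end Race

theorem mainTheorem4 {Ω : Type*} [MeasurableSpace Ω] (Pr : Measure Ω) [IsProbabilityMeasure Pr]
    (n : ℕ) (P : Measure (EuclideanSpace ℝ (Fin n))) [IsFiniteMeasure P] [NeZero P]
    (R : Ω → Set (RaceSpace n)) (hR : IsExponentialRace Pr P R) :
    (∀ᵐ ω ∂Pr, ∀ x, (arrivalTimes (R ω) x).Nonempty → ∃ t, IsLeast (arrivalTimes (R ω) x) t) ∧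
      IsGumbelProcess Pr P (fun ω x => raceGumbel (R ω) x) := by
  have hfin := ae_pointCount_timesBefore_ne_top hR.poisson
  refine ⟨?_, ?_, ?_, fun B hB => isGumbel_maxOver hR.poisson hB, fun m A hA hdisj => ?_⟩
  · filter_upwards [hfin] with ω hω x hx using exists_isLeast_arrivalTimes hω hx
  · filter_upwards [hfin] with ω hω x using raceGumbel_lt_top_iff.2 (firstArrival_pos hω x)
  · filter_upwards [hfin] with ω hω B _ hB
    obtain ⟨x, hx, hmin⟩ := exists_firstArrival_le hω hB
    exact ⟨x, hx, fun y hy => EReal.neg_le_neg_iff.2 (ENNReal.log_le_log (hmin y hy))⟩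
  · have h := (iIndepFun_firstArrivalIn hR.poisson hA hdisj).comp
      (fun _ t => -ENNReal.log t) (fun _ => ENNReal.measurable_log.neg)
    convert! h using 2 with j
    ext ω
    exact maxOver_raceGumbel (R ω) (A j)
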